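/- Let $L_x>0$, $a<b$, let $D_c=[0,L_x]\times[a,b]$, and consider real velocity fields $\vec v=(u,v)\in L^2(D_c)^2$ that are periodic in $x$ with period $L_x$, incompressible ($\partial_x u+\partial_y v=0$), satisfy $v=0$ at the walls $y=a,b$, and whose components have zero spatial average, $\int_{D_c}u\,dx\,dy=\int_{D_c}v\,dx\,dy=0$. Periodicity, incompressibility and the wall condition are understood weakly: $\int_{D_c}(u\,\partial_x\varphi+v\,\partial_y\varphi)\,dx\,dy=0$ for every $\varphi\in C^\infty(\mathbb R^2)$ of period $L_x$ in $x$. A function $\omega\in L^2(D_c)$ is the vorticity $\partial_x v-\partial_y u$ of such a field if $\int_{D_c}\omega\,\varphi\,dx\,dy=\int_{D_c}(u\,\partial_y\varphi-v\,\partial_x\varphi)\,dx\,dy$ for every $\varphi\in C^\infty(\mathbb R^2)$ of period $L_x$ in $x$ that vanishes outside $\mathbb R\times[c,d]$ for some $c,d$ with $a<c$ and $d<b$. Then for every $C>0$ the set $$S=\Big\{\vec v=(u,v)\ :\ \vec v \text{ is such a velocity field with a vorticity } \omega\in L^2(D_c) \text{ and } \int_a^b\int_0^{L_x}\omega^2\,dx\,dy\le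 C\Big\}$$ is compactly embedded in $L^2(D_c)$; that is, the closure of $S$ in $L^2(D_c)$ is a compact subset of $L^2(D_c)$. -/

import Mathlib

open MeasureTheory

noncomputable section

/-- The velocity values `(u, v)`, with the Euclidean norm. -/
abbrev Vel : Type := EuclideanSpace ℝ (Fin 2)

/-- The channel cell `D_c = [0, L] × [a, b]`. -/
def channelCell (L a b : ℝ) : Set (ℝ × ℝ) := Set.Icc 0 L ×ˢ Set.Icc a b

/-- Lebesgue measure on the channel cell. -/
def cellMeasure (L a b : ℝ) : Measure (ℝ × ℝ) := volume.restrict (channelCell L a b)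

/-- The kinetic energy space `L²(D_c)` of (real) velocity fields `(u, v)`. -/
abbrev CellL2 (L a b : ℝ) : Type := Lp Vel 2 (cellMeasure L a b)

/-- Partial derivative `∂φ/∂x`. -/
def partialX (φ : ℝ × ℝ → ℝ) (p : ℝ × ℝ) : ℝ := fderiv ℝ φ p (1, 0)

/-- Partial derivative `∂φ/∂y`. -/
def partialY (φ : ℝ × ℝ → ℝ) (p : ℝ × ℝ) : ℝ := fderiv ℝ φ p (0, 1)

/-- Smooth functions of period `L` in `x`, with no condition at the walls `y = a, b`. -/
structure IsPeriodicTest (L : ℝ) (φ : ℝ × ℝ → ℝ) : Prop where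
  smooth : ContDiff ℝ ((⊤ : ℕ∞) : WithTop ℕ∞) φ
  periodic : ∀ x y : ℝ, φ (x + L, y) = φ (x, y)

/-- Smooth functions of period `L` in `x` that vanish near the walls `y = a, b`
(that is, whose support in the period cylinder over the open channel is compact). -/
structure IsInteriorTest (L a b : ℝ) (φ : ℝ × ℝ → ℝ) : Prop extends IsPeriodicTest L φ where
  vanish : ∃ c d : ℝ, a < c ∧ d < b ∧ ∀ x y : ℝ, y ∉ Set.Icc c d → φ (x, y) = 0

/-- `∂u/∂x + ∂v/∂y = 0` in the channel, with `(u, v)` of period `L` in `x` and `v = 0` at the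
walls `y = a, b`, in the weak sense: `(u, v)` is orthogonal to the gradients of all smooth
`L`-periodic functions. Test functions that vanish near the walls express incompressibility across
the period cell; the others express the vanishing of the normal trace of `(u, v)`, which is `±v`,
at the walls. -/
def IsIncompressibleTangent (L a b : ℝ) (V : ℝ × ℝ → Vel) : Prop :=
  ∀ φ : ℝ × ℝ → ℝ, IsPeriodicTest L φ →
    ∫ p, (V p 0 * partialX φ p + V p 1 * partialY φ p) ∂(cellMeasure L a b) = 0

/-- `ω = ∂v/∂x - ∂u/∂y` in the sense of weak derivatives on the `x`-periodic channel. -/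
def IsWeakVorticity (L a b : ℝ) (V : ℝ × ℝ → Vel) (ω : ℝ × ℝ → ℝ) : Prop :=
  ∀ φ : ℝ × ℝ → ℝ, IsInteriorTest L a b φ →
    ∫ p, ω p * φ p ∂(cellMeasure L a b)
      = ∫ p, (V p 0 * partialY φ p - V p 1 * partialX φ p) ∂(cellMeasure L a b)

/-- The velocity fields of the channel flow: square integrable, incompressible, `L`-periodic in `x`,
with no penetration through the walls, and with vanishing spatial averages of `u` and `v`. -/
structure IsChannelVelocity (L a b : ℝ) (V : CellL2 L a b) : Prop where
  incompressible_tangent : IsIncompressibleTangent L a b V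
  average_u : ∫ p, V p 0 ∂(cellMeasure L a b) = 0
  average_v : ∫ p, V p 1 ∂(cellMeasure L a b) = 0

/-- The set `S` of all velocity fields of the channel flow whose vorticity `ω` (which is unique up
to null sets) is square integrable with enstrophy `∫∫ ω² dx dy ≤ C`. -/
def enstrophyBall (L a b C : ℝ) : Set (CellL2 L a b) :=
  {V | IsChannelVelocity L a b V ∧
    ∃ ω : ℝ × ℝ → ℝ, MemLp ω 2 (cellMeasure L a b) ∧ IsWeakVorticity L a b V ω ∧
      ∫ p, ω p ^ 2 ∂(cellMeasure L a b) ≤ C}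

end

/-! The vorticity controls every nonzero Fourier mode of the velocity with a gain of one derivative,
and such a gain gives compactness. Expand `u` in e^{iαx} cos(β(y-a)), and `v` and `ω` in e^{iαx}
sin(β(y-a)). Incompressibility with tangency, and the definition of vorticity, become linear
relations between coefficients, which combine to (α² + β²)(|û|² + |v̂|²) = |ω̂|²
(`wave_sq_mul_norm_velCoeff_sq`). The mode α = β = 0 is killed by the zero averages
(`velCoeff_zero`). By Parseval, the enstrophy bound then bounds each coefficient and makes the tails
over large wave vectors uniformly small, which is total boundedness in L²
(`totallyBounded_of_coeff`); completeness of L² gives compactness of the closure.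

Two points need work. Parseval for the mixed systems (`hasSum_sq_cos`, `hasSum_sq_sin`) comes from
the unit torus by reflecting evenly or oddly across a wall. The indices run over all of ℤ × ℤ, so
opposite indices repeat a profile up to sign; the constant L(b-a) reflects this redundancy. Also,
the sines vanish at the walls but not near them, so they are not test functions for the weak
vorticity; `IsWeakVorticity.integral_mul` reaches them through cutoffs. The cosines need no cutoff,
because incompressibility is tested with functions unrestricted at the walls. -/

noncomputable section

/-! ### Parseval's identity on the unit torus -/

/-- The period box `(0, 1] × (-1/2, 1/2]` of the unit torus. -/
def unitBox : Set (ℝ × ℝ) := Set.Ioc 0 1 ×ˢ Set.Ioc (-1 / 2) (1 / 2)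

lemma measurableSet_unitBox : MeasurableSet unitBox := measurableSet_Ioc.prod measurableSet_Ioc

section Torus

attribute [local instance] instMeasureSpaceUnitAddCircle
attribute [local instance] instIsProbabilityMeasureUnitAddCircleVolume

/-- **Parseval's identity** on the period box of the unit torus. -/
theorem hasSum_sq_fourier_unitBox {G : ℝ × ℝ → ℂ} (hG : MemLp G 2 (volume.restrict unitBox)) :
    HasSum (fun n : ℤ × ℤ => ‖∫ p in unitBox,
        Complex.exp (-(2 * Real.pi * (n.1 * p.1 + n.2 * p.2) : ℝ) * Complex.I) * G p‖ ^ 2)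
      (∫ p in unitBox, ‖G p‖ ^ 2) := by
  let c : Fin 2 → ℝ := ![0, -1 / 2]
  let box : Set (Fin 2 → ℝ) := {x | ∀ i, x i ∈ Set.Ioc (c i) (c i + 1)}
  have hbox : MeasurableSet box := MeasurableSet.univ_pi' fun i => measurableSet_Ioc
  have hpre : (MeasurableEquiv.finTwoArrow (α := ℝ)) ⁻¹' unitBox = box := by
    ext x
    simp only [unitBox, box, c, Set.mem_preimage, Set.mem_prod, Fin.forall_fin_two,
      Set.mem_ofPred_eq]
    norm_num [MeasurableEquiv.finTwoArrow]
  have hmp := volume_preserving_finTwoArrow ℝ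
  have hmp' : MeasurePreserving (MeasurableEquiv.finTwoArrow (α := ℝ))
      (volume.restrict box) (volume.restrict unitBox) := by
    rw [← hpre]; exact hmp.restrict_preimage measurableSet_unitBox
  let lift : UnitAddTorus (Fin 2) → ℝ × ℝ := fun z =>
    MeasurableEquiv.finTwoArrow (UnitAddTorus.measurableEquivPiIoc c z : Fin 2 → ℝ)
  have hlift : MeasurePreserving lift volume (volume.restrict unitBox) := by
    have h1 := UnitAddTorus.measurePreserving_equivPiIoc c
    have h2 : MeasurePreserving (Subtype.val : box → Fin 2 → ℝ)
        (Measure.comap Subtype.val volume) (volume.restrict box) :=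
      ⟨measurable_subtype_coe, map_comap_subtype_coe hbox volume⟩
    exact hmp'.comp (h2.comp h1)
  have hemb : MeasurableEmbedding lift :=
    (MeasurableEquiv.measurableEmbedding _).comp
      ((MeasurableEmbedding.subtype_coe hbox).comp (MeasurableEquiv.measurableEmbedding _))
  -- The coordinates of `lift z` represent `z` modulo 1, so the characters of the torus become the
  -- exponentials on the box.
  have hcoe : ∀ z : UnitAddTorus (Fin 2),
      z 0 = ((lift z).1 : UnitAddCircle) ∧ z 1 = ((lift z).2 : UnitAddCircle) := by
    intro z
    have := (UnitAddTorus.measurableEquivPiIoc c).symm_apply_apply z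
    exact ⟨(congrFun this 0).symm, (congrFun this 1).symm⟩
  have hmem : MemLp (G ∘ lift) 2 volume := hG.comp_measurePreserving hlift
  have key := UnitAddTorus.hasSum_sq_mFourierCoeff (d := Fin 2) (hmem.toLp _)
  have hnorm : ∫ t : UnitAddTorus (Fin 2), ‖hmem.toLp _ t‖ ^ 2 = ∫ p in unitBox, ‖G p‖ ^ 2 := by
    rw [← hlift.integral_comp hemb]
    refine integral_congr_ae ?_
    filter_upwards [hmem.coeFn_toLp] with t ht
    rw [ht, Function.comp_apply]
  have hcoef : ∀ i, UnitAddTorus.mFourierCoeff (hmem.toLp _ : UnitAddTorus (Fin 2) → ℂ) i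
      = ∫ p in unitBox,
        Complex.exp (-(2 * Real.pi * (i 0 * p.1 + i 1 * p.2) : ℝ) * Complex.I) * G p := by
    intro i
    rw [← hlift.integral_comp hemb]
    refine integral_congr_ae ?_
    filter_upwards [hmem.coeFn_toLp] with t ht
    obtain ⟨h0, h1⟩ := hcoe t
    rw [ht, Function.comp_apply, smul_eq_mul]
    congr 1
    simp only [UnitAddTorus.mFourier, ContinuousMap.coe_mk, Fin.prod_univ_two, Pi.neg_apply]
    rw [h0, h1, fourier_coe_apply, fourier_coe_apply, ← Complex.exp_add]
    congr 1
    push_cast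
    ring
  rw [hnorm] at key
  simp_rw [hcoef] at key
  exact (Equiv.hasSum_iff (finTwoArrowEquiv ℤ).symm).2 key

end Torus

/-! ### Folding the unit box onto the channel cell -/

lemma measurePreserving_affine_restrict {c : ℝ} (hc : c ≠ 0) (d : ℝ) {s t : Set ℝ}
    (hs : MeasurableSet s) (hst : (fun x => c * x + d) ⁻¹' s = t) :
    MeasurePreserving (fun x : ℝ => c * x + d) (volume.restrict t)
      (ENNReal.ofReal |c⁻¹| • volume.restrict s) := by
  have h1 : MeasurePreserving (fun x : ℝ => c * x) volume (ENNReal.ofReal |c⁻¹| • volume) :=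
    ⟨measurable_const_mul c, Real.map_volume_mul_left hc⟩
  have h2 : MeasurePreserving (fun x : ℝ => x + d) (ENNReal.ofReal |c⁻¹| • volume)
      (ENNReal.ofReal |c⁻¹| • volume) :=
    (measurePreserving_add_right volume d).smul_measure _
  have h3 := (h2.comp h1).restrict_preimage hs
  rw [Measure.restrict_smul] at h3
  rw [← hst]
  exact h3

/-- The fold of the unit box onto the channel cell, two to one in the second variable. -/
def foldMap (L a b : ℝ) (p : ℝ × ℝ) : ℝ × ℝ := (L * p.1, a + 2 * (b - a) * |p.2|)

/-- Each half of the interval covers `[a, b]` once, with slope ±2(b-a), and so contributes the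
density 1/(2(b-a)); the two halves add up. -/
lemma measurePreserving_fold_snd {a b : ℝ} (hab : a < b) :
    MeasurePreserving (fun t : ℝ => a + 2 * (b - a) * |t|)
      (volume.restrict (Set.Ioc (-1 / 2) (1 / 2)))
      (ENNReal.ofReal (b - a)⁻¹ • volume.restrict (Set.Icc a b)) := by
  have hH : 0 < b - a := sub_pos.2 hab
  have hpos := measurePreserving_affine_restrict (c := 2 * (b - a)) (by positivity) a
    (s := Set.Ioc a b) (t := Set.Ioc 0 (1 / 2)) measurableSet_Ioc (by
      ext t
      simp only [Set.mem_preimage, Set.mem_Ioc]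
      constructor
      · rintro ⟨h1, h2⟩; constructor <;> nlinarith
      · rintro ⟨h1, h2⟩; constructor <;> nlinarith)
  have hneg := measurePreserving_affine_restrict (c := -(2 * (b - a))) (by
      exact neg_ne_zero.2 (by positivity)) a
    (s := Set.Ico a b) (t := Set.Ioc (-1 / 2) 0) measurableSet_Ico (by
      ext t
      simp only [Set.mem_preimage, Set.mem_Ioc, Set.mem_Ico]
      constructor
      · rintro ⟨h1, h2⟩; constructor <;> nlinarith
      · rintro ⟨h1, h2⟩; constructor <;> nlinarith)
  refine ⟨by fun_prop, ?_⟩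
  rw [← Set.Ioc_union_Ioc_eq_Ioc (show (-1 / 2 : ℝ) ≤ 0 by norm_num)
    (show (0 : ℝ) ≤ 1 / 2 by norm_num), Measure.restrict_union
    (Set.Ioc_disjoint_Ioc_of_le le_rfl) measurableSet_Ioc, Measure.map_add _ _ (by fun_prop)]
  have e1 : Measure.map (fun t : ℝ => a + 2 * (b - a) * |t|) (volume.restrict (Set.Ioc (-1 / 2) 0))
      = ENNReal.ofReal (2 * (b - a))⁻¹ • volume.restrict (Set.Icc a b) := by
    rw [← restrict_Ico_eq_restrict_Icc, ← abs_of_pos (a := (2 * (b - a))⁻¹) (by positivity),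
      ← abs_neg, ← inv_neg, ← hneg.map_eq]
    refine Measure.map_congr ?_
    filter_upwards [ae_restrict_mem measurableSet_Ioc] with t ht
    rw [abs_of_nonpos ht.2]; ring
  have e2 : Measure.map (fun t : ℝ => a + 2 * (b - a) * |t|) (volume.restrict (Set.Ioc 0 (1 / 2)))
      = ENNReal.ofReal (2 * (b - a))⁻¹ • volume.restrict (Set.Icc a b) := by
    rw [← restrict_Ioc_eq_restrict_Icc, ← abs_of_pos (a := (2 * (b - a))⁻¹) (by positivity),
      ← hpos.map_eq]
    refine Measure.map_congr ?_
    filter_upwards [ae_restrict_mem measurableSet_Ioc] with t ht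
    rw [abs_of_pos ht.1]; ring
  rw [e1, e2, ← add_smul, ← ENNReal.ofReal_add (by positivity) (by positivity)]
  congr 2
  field_simp
  norm_num

lemma measurePreserving_foldMap {L a b : ℝ} (hL : 0 < L) (hab : a < b) :
    MeasurePreserving (foldMap L a b) (volume.restrict unitBox)
      (ENNReal.ofReal (L * (b - a))⁻¹ • cellMeasure L a b) := by
  have hx : MeasurePreserving (fun s : ℝ => L * s) (volume.restrict (Set.Ioc 0 1))
      (ENNReal.ofReal L⁻¹ • volume.restrict (Set.Icc 0 L)) := by
    have := measurePreserving_affine_restrict hL.ne' 0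
      (s := Set.Ioc 0 L) (t := Set.Ioc 0 1) measurableSet_Ioc (by
        ext t
        simp only [Set.mem_preimage, Set.mem_Ioc]
        constructor
        · rintro ⟨h1, h2⟩; constructor <;> nlinarith
        · rintro ⟨h1, h2⟩; constructor <;> nlinarith)
    simpa only [add_zero, abs_of_pos (inv_pos.2 hL), restrict_Ioc_eq_restrict_Icc] using this
  have := hx.prod (measurePreserving_fold_snd hab)
  rw [Measure.prod_restrict, ← Measure.volume_eq_prod, Measure.prod_smul_left,
    Measure.prod_smul_right, Measure.prod_restrict, ← Measure.volume_eq_prod, smul_smul,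
    ← ENNReal.ofReal_mul (inv_pos.2 hL).le, ← mul_inv] at this
  exact this

lemma integral_unitBox_eq_zero_of_odd {h : ℝ × ℝ → ℂ} (hodd : ∀ s t, h (s, -t) = -h (s, t)) :
    ∫ p in unitBox, h p = 0 := by
  have hneg : MeasurePreserving (fun t : ℝ => -t) (volume.restrict (Set.Ioc (-1 / 2) (1 / 2)))
      (volume.restrict (Set.Ioc (-1 / 2) (1 / 2))) := by
    -- The open interval is symmetric under negation, unlike the half-open one, and differs from it
    -- by a null set.
    have := (Measure.measurePreserving_neg (volume : Measure ℝ)).restrict_preimage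
      (s := Set.Ioo (-1 / 2) (1 / 2)) measurableSet_Ioo
    have hpre : Neg.neg ⁻¹' Set.Ioo (-1 / 2 : ℝ) (1 / 2) = Set.Ioo (-1 / 2) (1 / 2) := by
      ext t
      simp only [Set.mem_preimage, Set.mem_Ioo]
      constructor <;> rintro ⟨h1, h2⟩ <;> constructor <;> linarith
    rwa [hpre, restrict_Ioo_eq_restrict_Ioc] at this
  have hR := (MeasurePreserving.id (volume.restrict (Set.Ioc (0 : ℝ) 1))).prod hneg
  rw [Measure.prod_restrict, ← Measure.volume_eq_prod] at hR
  have hemb : MeasurableEmbedding (Prod.map (id : ℝ → ℝ) (fun t : ℝ => -t)) :=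
    ((MeasurableEquiv.refl ℝ).prodCongr (MeasurableEquiv.neg ℝ)).measurableEmbedding
  have h1 : ∫ p in unitBox, h (Prod.map id (fun t : ℝ => -t) p) = ∫ p in unitBox, h p :=
    hR.integral_comp hemb h
  have h2 : ∫ p in unitBox, h (Prod.map id (fun t : ℝ => -t) p) = -∫ p in unitBox, h p := by
    rw [← integral_neg]
    exact integral_congr_ae (.of_forall fun p => hodd p.1 p.2)
  rw [h1] at h2
  exact self_eq_neg.1 h2

instance (L a b : ℝ) : IsFiniteMeasure (cellMeasure L a b) :=
  ⟨by
    rw [cellMeasure, Measure.restrict_apply_univ]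
    exact (isCompact_Icc.prod isCompact_Icc).measure_lt_top⟩

instance : IsFiniteMeasure (volume.restrict unitBox) :=
  ⟨by
    rw [Measure.restrict_apply_univ]
    exact lt_of_le_of_lt (measure_mono (Set.prod_mono Set.Ioc_subset_Icc_self
      Set.Ioc_subset_Icc_self)) (isCompact_Icc.prod isCompact_Icc).measure_lt_top⟩

/-! ### Trigonometric Parseval identities on the channel cell -/

/-- The wave number `2πm/L` in the periodic direction. -/
def waveX (L : ℝ) (m : ℤ) : ℝ := 2 * Real.pi * m / L

/-- The wave number `kπ/(b-a)` in the direction across the channel. -/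
def waveY (a b : ℝ) (k : ℤ) : ℝ := Real.pi * k / (b - a)

variable {L a b : ℝ}

lemma integral_foldMap (hL : 0 < L) (hab : a < b) {E : Type*} [NormedAddCommGroup E]
    [NormedSpace ℝ E] {K : ℝ × ℝ → E} (hK : AEStronglyMeasurable K (cellMeasure L a b)) :
    ∫ p in unitBox, K (foldMap L a b p) = (L * (b - a))⁻¹ • ∫ p, K p ∂(cellMeasure L a b) := by
  have hF := measurePreserving_foldMap hL hab
  have hK' : AEStronglyMeasurable K (ENNReal.ofReal (L * (b - a))⁻¹ • cellMeasure L a b) :=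
    hK.smul_measure _
  rw [← hF.map_eq] at hK'
  rw [← integral_map hF.measurable.aemeasurable hK', hF.map_eq, integral_smul_measure,
    ENNReal.toReal_ofReal (inv_nonneg.2 (mul_pos hL (sub_pos.2 hab)).le)]

lemma MemLp.comp_foldMap (hL : 0 < L) (hab : a < b) {E : Type*} [NormedAddCommGroup E]
    {g : ℝ × ℝ → E} {q : ENNReal} (hg : MemLp g q (cellMeasure L a b)) :
    MemLp (g ∘ foldMap L a b) q (volume.restrict unitBox) :=
  (hg.smul_measure ENNReal.ofReal_ne_top).comp_measurePreserving (measurePreserving_foldMap hL hab)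

/-- If a box function differs from the lift of a cell function by a function that is odd in the
second variable, then their integrals agree up to the area of the cell. -/
lemma integral_unitBox_of_odd_sub (hL : 0 < L) (hab : a < b) {f K : ℝ × ℝ → ℂ}
    (hf : Integrable f (volume.restrict unitBox)) (hK : Integrable K (cellMeasure L a b))
    (hodd : ∀ s t, f (s, -t) - K (foldMap L a b (s, -t)) = -(f (s, t) - K (foldMap L a b (s, t)))) :
    ∫ p in unitBox, f p = (L * (b - a))⁻¹ • ∫ p, K p ∂(cellMeasure L a b) := by
  have hK' : Integrable (fun p => K (foldMap L a b p)) (volume.restrict unitBox) :=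
    memLp_one_iff_integrable.1 (MemLp.comp_foldMap hL hab (memLp_one_iff_integrable.2 hK))
  rw [← integral_foldMap hL hab hK.aestronglyMeasurable, ← sub_eq_zero, ← integral_sub hf hK']
  exact integral_unitBox_eq_zero_of_odd hodd

lemma integrable_mul_of_continuous {g f : ℝ × ℝ → ℝ} (hg : Integrable g (cellMeasure L a b))
    (hf : Continuous f) : Integrable (fun p => g p * f p) (cellMeasure L a b) := by
  have hK : IsCompact (channelCell L a b) := isCompact_Icc.prod isCompact_Icc
  obtain ⟨C, hC⟩ := hK.exists_bound_of_continuousOn hf.continuousOn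
  exact hg.mul_bdd (c := C) hf.aestronglyMeasurable
    (ae_restrict_of_forall_mem hK.measurableSet hC)

lemma exp_neg_add_mul_I (A B : ℝ) : Complex.exp (-(A + B : ℝ) * Complex.I)
    = Complex.exp (-(A : ℝ) * Complex.I) * (Real.cos B - Real.sin B * Complex.I) := by
  have : (-(A + B : ℝ) * Complex.I : ℂ) = -(A : ℝ) * Complex.I + ((-B : ℝ) : ℂ) * Complex.I := by
    push_cast; ring
  rw [this, Complex.exp_add, Complex.exp_mul_I ((-B : ℝ) : ℂ), ← Complex.ofReal_cos,
    ← Complex.ofReal_sin, Real.cos_neg, Real.sin_neg]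
  push_cast; ring

lemma waveX_mul (hL : 0 < L) (m : ℤ) (s : ℝ) : waveX L m * (L * s) = 2 * Real.pi * (m * s) := by
  unfold waveX; field_simp

lemma waveY_mul (hab : a < b) (k : ℤ) (t : ℝ) :
    waveY a b k * (a + 2 * (b - a) * t - a) = 2 * Real.pi * k * t := by
  have hH : b - a ≠ 0 := (sub_pos.2 hab).ne'
  unfold waveY; field_simp; ring

/-- Parseval's identity on the cell, for a lift to the unit box and the profiles `T k` across the
channel that the Fourier modes reduce to. -/
lemma hasSum_sq_of_lift (hL : 0 < L) (hab : a < b) {g : ℝ × ℝ → ℝ}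
    (hg : MemLp g 2 (cellMeasure L a b)) {G : ℝ × ℝ → ℂ} {T : ℤ → ℝ → ℝ} (ζ : ℂ) (hζ : ‖ζ‖ = 1)
    (hGm : AEStronglyMeasurable G (volume.restrict unitBox))
    (hGn : ∀ᵐ p ∂(volume.restrict unitBox), ‖G p‖ = |g (foldMap L a b p)|)
    (hT : ∀ k, Continuous (T k))
    (hodd : ∀ (m k : ℤ) (s t : ℝ),
      let d : ℝ → ℂ := fun t =>
        Complex.exp (-(2 * Real.pi * (m * s + k * t) : ℝ) * Complex.I) * G (s, t)
          - ζ * (Complex.exp (-(waveX L m * (foldMap L a b (s, t)).1 : ℝ) * Complex.I)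
            * (T k (foldMap L a b (s, t)).2 * g (foldMap L a b (s, t)) : ℝ))
      d (-t) = -d t) :
    HasSum (fun n : ℤ × ℤ =>
        (∫ p, g p * (Real.cos (waveX L n.1 * p.1) * T n.2 p.2) ∂(cellMeasure L a b)) ^ 2
        + (∫ p, g p * (Real.sin (waveX L n.1 * p.1) * T n.2 p.2) ∂(cellMeasure L a b)) ^ 2)
      (L * (b - a) * ∫ p, g p ^ 2 ∂(cellMeasure L a b)) := by
  have hA : 0 < L * (b - a) := mul_pos hL (sub_pos.2 hab)
  have hgF := MemLp.comp_foldMap hL hab hg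
  have hG : MemLp G 2 (volume.restrict unitBox) :=
    hgF.of_le hGm (by filter_upwards [hGn] with p hp using hp.le)
  have hbd : ∀ f : ℝ × ℝ → ℝ, Continuous f →
      Integrable (fun p => g p * f p) (cellMeasure L a b) := fun f hf =>
    integrable_mul_of_continuous (hg.integrable one_le_two) hf
  have key := hasSum_sq_fourier_unitBox hG
  have hnorm : ∫ p in unitBox, ‖G p‖ ^ 2
      = (L * (b - a))⁻¹ * ∫ p, g p ^ 2 ∂(cellMeasure L a b) := by
    rw [← smul_eq_mul, ← integral_foldMap hL hab (K := fun p => g p ^ 2)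
      (hg.aestronglyMeasurable.pow 2)]
    refine integral_congr_ae ?_
    filter_upwards [hGn] with p hp
    rw [hp, sq_abs]
  -- Up to the unimodular factor `ζ`, the cosine and sine pairings are the real and minus the
  -- imaginary part of the coefficient, because `g` and `T` are real.
  have hcoef : ∀ n : ℤ × ℤ, ‖∫ p in unitBox,
        Complex.exp (-(2 * Real.pi * (n.1 * p.1 + n.2 * p.2) : ℝ) * Complex.I) * G p‖ ^ 2
      = (L * (b - a))⁻¹ ^ 2 * (
        (∫ p, g p * (Real.cos (waveX L n.1 * p.1) * T n.2 p.2) ∂(cellMeasure L a b)) ^ 2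
        + (∫ p, g p * (Real.sin (waveX L n.1 * p.1) * T n.2 p.2) ∂(cellMeasure L a b)) ^ 2) := by
    rintro ⟨m, k⟩
    have hTk := hT k
    have hc := hbd (fun p => Real.cos (waveX L m * p.1) * T k p.2) (by fun_prop)
    have hs := hbd (fun p => Real.sin (waveX L m * p.1) * T k p.2) (by fun_prop)
    have hexp : ∀ p : ℝ × ℝ, Complex.exp (-(waveX L m * p.1 : ℝ) * Complex.I)
          * (T k p.2 * g p : ℝ)
        = (g p * (Real.cos (waveX L m * p.1) * T k p.2) : ℝ)
          - (g p * (Real.sin (waveX L m * p.1) * T k p.2) : ℝ) * Complex.I := by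
      intro p
      rw [← Complex.ofReal_neg, Complex.exp_mul_I, ← Complex.ofReal_cos, ← Complex.ofReal_sin,
        Real.cos_neg, Real.sin_neg]
      push_cast
      ring
    have hI := integral_unitBox_of_odd_sub hL hab
      (f := fun p => Complex.exp (-(2 * Real.pi * (m * p.1 + k * p.2) : ℝ) * Complex.I) * G p)
      (K := fun p => ζ * (Complex.exp (-(waveX L m * p.1 : ℝ) * Complex.I)
        * (T k p.2 * g p : ℝ)))
      ((hG.integrable one_le_two).bdd_mul (c := 1) (by
          exact Continuous.aestronglyMeasurable (by fun_prop)) (.of_forall fun p => by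
          rw [← Complex.ofReal_neg, Complex.norm_exp_ofReal_mul_I]))
      (by
        simp_rw [hexp]
        exact ((hc.ofReal.sub (hs.ofReal.mul_const _)).const_mul _))
      (fun s t => hodd m k s t)
    simp only
    rw [hI, integral_const_mul]
    simp_rw [hexp]
    rw [integral_sub hc.ofReal (hs.ofReal.mul_const _), integral_mul_const,
      integral_complex_ofReal, integral_complex_ofReal, norm_smul, norm_mul, hζ, one_mul, mul_pow,
      ← Complex.normSq_eq_norm_sq, Complex.normSq_apply, Real.norm_eq_abs, sq_abs]
    congr 1
    simp
    ring
  rw [hnorm] at key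
  simp_rw [hcoef] at key
  -- The squared coefficients carry the inverse area squared, the norm only one inverse area; a
  -- factor L(b-a) survives on the right.
  have := key.mul_left ((L * (b - a)) ^ 2)
  have hA2 : (L * (b - a)) ^ 2 * (L * (b - a))⁻¹ ^ 2 = 1 := by
    rw [← mul_pow, mul_inv_cancel₀ hA.ne', one_pow]
  have hA1 : (L * (b - a)) ^ 2 * (L * (b - a))⁻¹ = L * (b - a) := by
    rw [pow_two, mul_assoc, mul_inv_cancel₀ hA.ne', mul_one]
  simpa only [← mul_assoc ((L * (b - a)) ^ 2), hA2, hA1, one_mul] using this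

/-- **Parseval's identity** on the channel cell, for the system `e^{iαx} cos(β(y-a))`. -/
theorem hasSum_sq_cos (hL : 0 < L) (hab : a < b) {g : ℝ × ℝ → ℝ}
    (hg : MemLp g 2 (cellMeasure L a b)) :
    HasSum (fun n : ℤ × ℤ =>
        (∫ p, g p * (Real.cos (waveX L n.1 * p.1) * Real.cos (waveY a b n.2 * (p.2 - a)))
          ∂(cellMeasure L a b)) ^ 2
        + (∫ p, g p * (Real.sin (waveX L n.1 * p.1) * Real.cos (waveY a b n.2 * (p.2 - a)))
          ∂(cellMeasure L a b)) ^ 2)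
      (L * (b - a) * ∫ p, g p ^ 2 ∂(cellMeasure L a b)) := by
  refine hasSum_sq_of_lift hL hab hg (G := fun p => (g (foldMap L a b p) : ℂ))
    (T := fun k y => Real.cos (waveY a b k * (y - a))) 1 (by simp)
    (MemLp.comp_foldMap hL hab hg).ofReal.aestronglyMeasurable
    (.of_forall fun p => by simp) (fun k => by fun_prop) ?_
  intro m k s t d
  -- The lift is even in `t`, so the cosine part of the exponential is the lift of a cell function
  -- and the sine part is the odd remainder.
  have hd : ∀ t, d t = Complex.exp (-(2 * Real.pi * (m * s) : ℝ) * Complex.I)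
      * (-Complex.I * Real.sin (2 * Real.pi * k * t) * g (foldMap L a b (s, t))) := by
    intro t
    have h2 : Real.cos (2 * Real.pi * k * |t|) = Real.cos (2 * Real.pi * k * t) := by
      rcases abs_cases t with ⟨h, -⟩ | ⟨h, -⟩ <;> rw [h]
      rw [mul_neg, Real.cos_neg]
    simp only [d]
    rw [show 2 * Real.pi * (m * s + k * t) = 2 * Real.pi * (m * s) + 2 * Real.pi * k * t by ring,
      exp_neg_add_mul_I]
    simp only [foldMap]
    rw [waveX_mul hL, waveY_mul hab, h2]
    push_cast
    ring
  rw [hd, hd]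
  simp only [foldMap, abs_neg, mul_neg, Real.sin_neg]
  push_cast
  ring

/-- **Parseval's identity** on the channel cell, for the system `e^{iαx} sin(β(y-a))`. -/
theorem hasSum_sq_sin (hL : 0 < L) (hab : a < b) {g : ℝ × ℝ → ℝ}
    (hg : MemLp g 2 (cellMeasure L a b)) :
    HasSum (fun n : ℤ × ℤ =>
        (∫ p, g p * (Real.cos (waveX L n.1 * p.1) * Real.sin (waveY a b n.2 * (p.2 - a)))
          ∂(cellMeasure L a b)) ^ 2
        + (∫ p, g p * (Real.sin (waveX L n.1 * p.1) * Real.sin (waveY a b n.2 * (p.2 - a)))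
          ∂(cellMeasure L a b)) ^ 2)
      (L * (b - a) * ∫ p, g p ^ 2 ∂(cellMeasure L a b)) := by
  refine hasSum_sq_of_lift hL hab hg
    (G := fun p => ((Real.sign p.2 : ℝ) : ℂ) * (g (foldMap L a b p) : ℂ))
    (T := fun k y => Real.sin (waveY a b k * (y - a))) (-Complex.I) (by simp)
    ?_ ?_ (fun k => by fun_prop) ?_
  · refine AEStronglyMeasurable.mul ?_ (MemLp.comp_foldMap hL hab hg).ofReal.aestronglyMeasurable
    have : Measurable Real.sign := by
      unfold Real.sign
      exact Measurable.ite measurableSet_Iio measurable_const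
        (Measurable.ite measurableSet_Ioi measurable_const measurable_const)
    exact (Complex.measurable_ofReal.comp (this.comp measurable_snd)).aestronglyMeasurable
  -- `Real.sign 0 = 0`, so the moduli agree only off the null line `t = 0`.
  · have h0 : ∀ᵐ p : ℝ × ℝ, p.2 ≠ 0 := by
      rw [Measure.volume_eq_prod]
      exact Measure.quasiMeasurePreserving_snd.ae (Measure.ae_ne volume 0)
    filter_upwards [ae_restrict_of_ae h0] with p hp
    rcases hp.lt_or_gt with h | h
    · simp [Real.sign_of_neg h]
    · simp [Real.sign_of_pos h]
  intro m k s t d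
  -- For the odd lift the roles swap: sign(t) sin(2πkt) = sin(2πk|t|) descends to the cell, and the
  -- cosine part is odd.
  have hd : ∀ t, d t = Complex.exp (-(2 * Real.pi * (m * s) : ℝ) * Complex.I)
      * (Real.sign t * Real.cos (2 * Real.pi * k * t) * g (foldMap L a b (s, t))) := by
    intro t
    have h2 : Real.sin (2 * Real.pi * k * |t|) = Real.sign t * Real.sin (2 * Real.pi * k * t) := by
      rcases lt_trichotomy t 0 with h | h | h
      · rw [abs_of_neg h, Real.sign_of_neg h, mul_neg, Real.sin_neg, neg_one_mul]
      · simp [h]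
      · rw [abs_of_pos h, Real.sign_of_pos h, one_mul]
    simp only [d]
    rw [show 2 * Real.pi * (m * s + k * t) = 2 * Real.pi * (m * s) + 2 * Real.pi * k * t by ring,
      exp_neg_add_mul_I]
    simp only [foldMap]
    rw [waveX_mul hL, waveY_mul hab, h2]
    push_cast
    ring
  rw [hd, hd]
  simp only [foldMap, abs_neg, mul_neg, Real.cos_neg, Real.sign_neg]
  push_cast
  ring

/-! ### Cutoffs near the walls -/

/-- The derivative is zero outside `[0, 1]`. The weight is chosen for the substitution x = Nz - 1,
where x + 1 = Nz: it yields a bound on Nz times the derivative that does not depend on N. -/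
lemma exists_bound_mul_deriv_smoothTransition :
    ∃ M : ℝ, 0 ≤ M ∧ ∀ x : ℝ, |(x + 1) * deriv Real.smoothTransition x| ≤ M := by
  have hc : Continuous fun x : ℝ => (x + 1) * deriv Real.smoothTransition x := by
    have : Continuous (deriv Real.smoothTransition) :=
      (Real.smoothTransition.contDiff (n := 1)).continuous_deriv le_rfl
    fun_prop
  obtain ⟨M, hM⟩ := (isCompact_Icc (a := (0 : ℝ)) (b := 1)).exists_bound_of_continuousOn
    hc.continuousOn
  have hM0 : 0 ≤ M := (norm_nonneg _).trans (hM 0 ⟨le_rfl, zero_le_one⟩)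
  refine ⟨M, hM0, fun x => ?_⟩
  rcases lt_or_ge x 0 with h | h
  · have : Real.smoothTransition =ᶠ[nhds x] fun _ => 0 := by
      filter_upwards [Iio_mem_nhds h] with z hz using Real.smoothTransition.zero_of_nonpos hz.le
    rw [this.deriv_eq]; simpa using hM0
  rcases le_or_gt x 1 with h' | h'
  · exact hM x ⟨h, h'⟩
  · have : Real.smoothTransition =ᶠ[nhds x] fun _ => 1 := by
      filter_upwards [Ioi_mem_nhds h'] with z hz using Real.smoothTransition.one_of_one_le hz.le
    rw [this.deriv_eq]; simpa using hM0

lemma abs_smoothTransition_le_one (x : ℝ) : |Real.smoothTransition x| ≤ 1 := by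
  rw [abs_of_nonneg (Real.smoothTransition.nonneg x)]
  exact Real.smoothTransition.le_one x

/-- A smooth function vanishing at both ends of `[a, b]` is a bounded pointwise limit, together
with its derivative, of smooth functions vanishing near the ends. -/
lemma exists_interior_approx {h : ℝ → ℝ} (hh : ContDiff ℝ ((⊤ : ℕ∞) : WithTop ℕ∞) h) {K : ℝ}
    (hK : 0 ≤ K) (ha : ∀ y ∈ Set.Icc a b, |h y| ≤ K * (y - a))
    (hb : ∀ y ∈ Set.Icc a b, |h y| ≤ K * (b - y)) :
    ∃ (H : ℕ → ℝ → ℝ) (C : ℝ), (∀ n, ContDiff ℝ ((⊤ : ℕ∞) : WithTop ℕ∞) (H n)) ∧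
      (∀ n, ∃ c d : ℝ, a < c ∧ d < b ∧ ∀ y, y ∉ Set.Icc c d → H n y = 0) ∧
      (∀ n, ∀ y ∈ Set.Icc a b, |H n y| ≤ C ∧ |deriv (H n) y| ≤ C) ∧
      ∀ y ∈ Set.Ioo a b, ∀ᶠ n in Filter.atTop, H n y = h y ∧ deriv (H n) y = deriv h y := by
  obtain ⟨M, hM0, hM⟩ := exists_bound_mul_deriv_smoothTransition
  obtain ⟨C₀, hC₀⟩ := (isCompact_Icc (a := a) (b := b)).exists_bound_of_continuousOn
    hh.continuous.continuousOn
  have hh' : Continuous (deriv h) := hh.continuous_deriv (by simp)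
  obtain ⟨C₁, hC₁⟩ := (isCompact_Icc (a := a) (b := b)).exists_bound_of_continuousOn
    hh'.continuousOn
  let N : ℕ → ℝ := fun n => n + 1
  have hN : ∀ n, 0 < N n := fun n => by positivity
  -- This cutoff is 0 for y - a ≤ 1/N and 1 for y - a ≥ 2/N; `B` does the same at the other wall.
  let A : ℕ → ℝ → ℝ := fun n y => Real.smoothTransition (N n * (y - a) - 1)
  let B : ℕ → ℝ → ℝ := fun n y => Real.smoothTransition (N n * (b - y) - 1)
  have hst : ContDiff ℝ ((⊤ : ℕ∞) : WithTop ℕ∞) Real.smoothTransition :=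
    Real.smoothTransition.contDiff
  have hAs : ∀ n, ContDiff ℝ ((⊤ : ℕ∞) : WithTop ℕ∞) (A n) := fun n => hst.comp (by fun_prop)
  have hBs : ∀ n, ContDiff ℝ ((⊤ : ℕ∞) : WithTop ℕ∞) (B n) := fun n => hst.comp (by fun_prop)
  have hstd : ∀ x, HasDerivAt Real.smoothTransition (deriv Real.smoothTransition x) x := fun x =>
    (hst.differentiable (by simp) x).hasDerivAt
  have hAd : ∀ n y, HasDerivAt (A n)
      (deriv Real.smoothTransition (N n * (y - a) - 1) * N n) y := by
    intro n y
    have : HasDerivAt (fun y => N n * (y - a) - 1) (N n) y := by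
      simpa using (((hasDerivAt_id y).sub_const a).const_mul (N n)).sub_const 1
    exact (hstd _).comp y this
  have hBd : ∀ n y, HasDerivAt (B n)
      (deriv Real.smoothTransition (N n * (b - y) - 1) * -N n) y := by
    intro n y
    have : HasDerivAt (fun y => N n * (b - y) - 1) (-N n) y := by
      simpa using (((hasDerivAt_id y).const_sub b).const_mul (N n)).sub_const 1
    exact (hstd _).comp y this
  -- The cutoff's derivative has size N, but only at distance of order 1/N from the wall, where the
  -- linear bound on `w` compensates.
  have key : ∀ n z w, 0 ≤ z → |w| ≤ K * z →
      |deriv Real.smoothTransition (N n * z - 1) * N n| * |w| ≤ K * M := by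
    intro n z w hz hw
    have h1 := hM (N n * z - 1)
    rw [sub_add_cancel, abs_mul, abs_of_nonneg (mul_nonneg (hN n).le hz)] at h1
    calc |deriv Real.smoothTransition (N n * z - 1) * N n| * |w|
        ≤ |deriv Real.smoothTransition (N n * z - 1) * N n| * (K * z) := by gcongr
      _ = K * (N n * z * |deriv Real.smoothTransition (N n * z - 1)|) := by
        rw [abs_mul, abs_of_pos (hN n)]; ring
      _ ≤ K * M := by gcongr
  refine ⟨fun n y => A n y * B n y * h y, |C₀| + (K * M + K * M + |C₁|),
    fun n => ((hAs n).mul (hBs n)).mul hh, fun n => ?_, fun n y hy => ?_, fun y hy => ?_⟩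
  · refine ⟨a + 1 / N n, b - 1 / N n, by simpa using hN n, by simpa using hN n, fun y hy => ?_⟩
    have hinv : N n * (1 / N n) = 1 := by field_simp [(hN n).ne']
    rw [Set.mem_Icc, not_and_or, not_le, not_le] at hy
    rcases hy with hy | hy
    · have : A n y = 0 := Real.smoothTransition.zero_of_nonpos (by nlinarith [hN n])
      simp [this]
    · have : B n y = 0 := Real.smoothTransition.zero_of_nonpos (by nlinarith [hN n])
      simp [this]
  · have hA1 : |A n y| ≤ 1 := abs_smoothTransition_le_one _
    have hB1 : |B n y| ≤ 1 := abs_smoothTransition_le_one _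
    have hAB : |A n y * B n y| ≤ 1 := by
      rw [abs_mul]; exact mul_le_one₀ hA1 (abs_nonneg _) hB1
    have e0 : |h y| ≤ |C₀| := (hC₀ y hy).trans (le_abs_self _)
    have e1 : |deriv h y| ≤ |C₁| := (hC₁ y hy).trans (le_abs_self _)
    have hKM : 0 ≤ K * M := mul_nonneg hK hM0
    constructor
    · rw [abs_mul]
      calc |A n y * B n y| * |h y| ≤ 1 * |C₀| := by gcongr
        _ ≤ _ := by linarith [abs_nonneg C₁]
    · have hd := ((hAd n y).mul (hBd n y)).mul (hh.differentiable (by simp) y).hasDerivAt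
      have hd' : deriv (fun y => A n y * B n y * h y) y = _ := hd.deriv
      rw [hd']
      have k1 := key n (y - a) (h y) (by linarith [hy.1]) (ha y hy)
      have k2 := key n (b - y) (h y) (by linarith [hy.2]) (hb y hy)
      set dA := deriv Real.smoothTransition (N n * (y - a) - 1) * N n
      set dB := deriv Real.smoothTransition (N n * (b - y) - 1)
      have t1 : |dA * B n y * h y| ≤ K * M := by
        rw [abs_mul, abs_mul]
        calc |dA| * |B n y| * |h y| ≤ |dA| * 1 * |h y| := by gcongr
          _ ≤ K * M := by rw [mul_one]; exact k1
      have t2 : |A n y * (dB * -N n) * h y| ≤ K * M := by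
        rw [abs_mul, abs_mul, mul_neg, abs_neg]
        calc |A n y| * |dB * N n| * |h y| ≤ 1 * |dB * N n| * |h y| := by gcongr
          _ ≤ K * M := by rw [one_mul]; exact k2
      have t3 : |A n y * B n y * deriv h y| ≤ |C₁| := by
        rw [abs_mul]
        calc |A n y * B n y| * |deriv h y| ≤ 1 * |C₁| := by gcongr
          _ = |C₁| := one_mul _
      calc |(dA * B n y + A n y * (dB * -N n)) * h y + A n y * B n y * deriv h y|
          = |dA * B n y * h y + A n y * (dB * -N n) * h y + A n y * B n y * deriv h y| := by
            rw [add_mul]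
        _ ≤ |dA * B n y * h y| + |A n y * (dB * -N n) * h y| + |A n y * B n y * deriv h y| :=
            abs_add_three _ _ _
        _ ≤ _ := by linarith [abs_nonneg C₀]
  · have lim : ∀ z : ℝ, 0 < z → ∀ᶠ n in Filter.atTop, 1 < N n * z - 1 := by
      intro z hz
      have : Filter.Tendsto (fun n : ℕ => (n : ℝ) * z) Filter.atTop Filter.atTop :=
        tendsto_natCast_atTop_atTop.atTop_mul_const hz
      filter_upwards [this.eventually_gt_atTop 2] with n hn
      simp only [N]; nlinarith
    filter_upwards [lim (y - a) (sub_pos.2 hy.1), lim (b - y) (sub_pos.2 hy.2)] with n h1 h2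
    -- The strict inequalities persist near `y`, so both cutoffs are 1 on a neighbourhood and the
    -- derivatives agree as well.
    have hev : (fun y => A n y * B n y * h y) =ᶠ[nhds y] h := by
      have c1 : ∀ᶠ z in nhds y, 1 < N n * (z - a) - 1 :=
        (by fun_prop : Continuous fun z => N n * (z - a) - 1).continuousAt.eventually
          (lt_mem_nhds h1)
      have c2 : ∀ᶠ z in nhds y, 1 < N n * (b - z) - 1 :=
        (by fun_prop : Continuous fun z => N n * (b - z) - 1).continuousAt.eventually
          (lt_mem_nhds h2)
      filter_upwards [c1, c2] with z hz1 hz2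
      simp only [A, B]
      rw [Real.smoothTransition.one_of_one_le hz1.le, Real.smoothTransition.one_of_one_le hz2.le]
      ring
    exact ⟨hev.eq_of_nhds, hev.deriv_eq⟩

/-! ### The weak equations tested against products -/

lemma hasFDerivAt_mul_fst_snd {f h : ℝ → ℝ} (hf : Differentiable ℝ f) (hh : Differentiable ℝ h)
    (p : ℝ × ℝ) : HasFDerivAt (fun p : ℝ × ℝ => f p.1 * h p.2)
      (f p.1 • (deriv h p.2 • ContinuousLinearMap.snd ℝ ℝ ℝ)
        + h p.2 • (deriv f p.1 • ContinuousLinearMap.fst ℝ ℝ ℝ)) p := by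
  have h1 := (hf p.1).hasDerivAt.comp_hasFDerivAt p (hasFDerivAt_fst (𝕜 := ℝ) (p := p))
  have h2 := (hh p.2).hasDerivAt.comp_hasFDerivAt p (hasFDerivAt_snd (𝕜 := ℝ) (p := p))
  exact h1.mul h2

lemma partialX_mul_fst_snd {f h : ℝ → ℝ} (hf : Differentiable ℝ f) (hh : Differentiable ℝ h)
    (p : ℝ × ℝ) : partialX (fun p : ℝ × ℝ => f p.1 * h p.2) p = deriv f p.1 * h p.2 := by
  rw [partialX, (hasFDerivAt_mul_fst_snd hf hh p).fderiv]
  simp [mul_comm]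

lemma partialY_mul_fst_snd {f h : ℝ → ℝ} (hf : Differentiable ℝ f) (hh : Differentiable ℝ h)
    (p : ℝ × ℝ) : partialY (fun p : ℝ × ℝ => f p.1 * h p.2) p = f p.1 * deriv h p.2 := by
  rw [partialY, (hasFDerivAt_mul_fst_snd hf hh p).fderiv]
  simp

lemma isPeriodicTest_mul {f h : ℝ → ℝ} (hf : ContDiff ℝ ((⊤ : ℕ∞) : WithTop ℕ∞) f)
    (hfp : Function.Periodic f L) (hh : ContDiff ℝ ((⊤ : ℕ∞) : WithTop ℕ∞) h) :
    IsPeriodicTest L fun p => f p.1 * h p.2 :=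
  ⟨(hf.comp contDiff_fst).mul (hh.comp contDiff_snd), fun x y => by simp only [hfp x]⟩

/-- The pairing of `g` with the product `f(x) h(y)` on the channel cell. -/
def cellPairing (L a b : ℝ) (g : ℝ × ℝ → ℝ) (f h : ℝ → ℝ) : ℝ :=
  ∫ p, g p * (f p.1 * h p.2) ∂(cellMeasure L a b)

/-- Incompressibility and tangency, tested against a product. -/
lemma IsIncompressibleTangent.integral_mul {V : ℝ × ℝ → Vel} (hV : IsIncompressibleTangent L a b V)
    (h0 : Integrable (fun p => V p 0) (cellMeasure L a b))
    (h1 : Integrable (fun p => V p 1) (cellMeasure L a b)) {f h : ℝ → ℝ}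
    (hf : ContDiff ℝ ((⊤ : ℕ∞) : WithTop ℕ∞) f)
    (hfp : Function.Periodic f L) (hh : ContDiff ℝ ((⊤ : ℕ∞) : WithTop ℕ∞) h) :
    cellPairing L a b (fun p => V p 0) (deriv f) h
      = -cellPairing L a b (fun p => V p 1) f (deriv h) := by
  have hf' : Continuous (deriv f) := hf.continuous_deriv (by simp)
  have hh' : Continuous (deriv h) := hh.continuous_deriv (by simp)
  have hf0 := hf.continuous
  have hh0 := hh.continuous
  have := hV _ (isPeriodicTest_mul hf hfp hh)
  simp_rw [partialX_mul_fst_snd (hf.differentiable (by simp)) (hh.differentiable (by simp)),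
    partialY_mul_fst_snd (hf.differentiable (by simp)) (hh.differentiable (by simp))] at this
  rw [integral_add (integrable_mul_of_continuous h0 (by fun_prop))
    (integrable_mul_of_continuous h1 (by fun_prop))] at this
  exact eq_neg_of_add_eq_zero_left this

lemma ae_cell_mem_Ioo : ∀ᵐ p ∂(cellMeasure L a b), p.2 ∈ Set.Ioo a b := by
  have h0 : ∀ c : ℝ, ∀ᵐ p : ℝ × ℝ, p.2 ≠ c := by
    intro c
    rw [Measure.volume_eq_prod]
    exact Measure.quasiMeasurePreserving_snd.ae (Measure.ae_ne volume c)
  filter_upwards [ae_restrict_of_ae (h0 a), ae_restrict_of_ae (h0 b),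
    ae_restrict_mem (measurableSet_Icc.prod measurableSet_Icc)] with p ha hb hp
  exact ⟨lt_of_le_of_ne hp.2.1 (Ne.symm ha), lt_of_le_of_ne hp.2.2 hb⟩

/-- Dominated convergence: the cutoff derivatives stay bounded but need not converge uniformly, and
the walls, where pointwise convergence may fail, are null. -/
lemma tendsto_integral_mul_of_bounded {g : ℝ × ℝ → ℝ} (hg : Integrable g (cellMeasure L a b))
    {f : ℝ → ℝ} (hf : Continuous f) {H : ℕ → ℝ → ℝ} {h : ℝ → ℝ} {C : ℝ}
    (hH : ∀ n, Continuous (H n)) (hC : ∀ n, ∀ y ∈ Set.Icc a b, |H n y| ≤ C)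
    (hlim : ∀ y ∈ Set.Ioo a b, ∀ᶠ n in Filter.atTop, H n y = h y) :
    Filter.Tendsto (fun n => ∫ p, g p * (f p.1 * H n p.2) ∂(cellMeasure L a b)) Filter.atTop
      (nhds (∫ p, g p * (f p.1 * h p.2) ∂(cellMeasure L a b))) := by
  refine tendsto_integral_of_dominated_convergence (fun p => |g p * f p.1| * C) ?_ ?_ ?_ ?_
  · intro n
    have := hH n
    exact (integrable_mul_of_continuous hg (by fun_prop)).aestronglyMeasurable
  · exact ((integrable_mul_of_continuous hg (by fun_prop)).abs).mul_const C
  · intro n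
    filter_upwards [ae_cell_mem_Ioo] with p hp
    rw [← mul_assoc, Real.norm_eq_abs, abs_mul]
    gcongr
    exact hC n _ (Set.Ioo_subset_Icc_self hp)
  · filter_upwards [ae_cell_mem_Ioo] with p hp
    refine tendsto_const_nhds.congr' ?_
    filter_upwards [hlim _ hp] with n hn
    rw [hn]

/-- The weak vorticity, tested against a product that merely vanishes at the walls. -/
lemma IsWeakVorticity.integral_mul {V : ℝ × ℝ → Vel} {ω : ℝ × ℝ → ℝ}
    (hω : IsWeakVorticity L a b V ω)
    (h0 : Integrable (fun p => V p 0) (cellMeasure L a b))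
    (h1 : Integrable (fun p => V p 1) (cellMeasure L a b))
    (hωi : Integrable ω (cellMeasure L a b)) {f h : ℝ → ℝ}
    (hf : ContDiff ℝ ((⊤ : ℕ∞) : WithTop ℕ∞) f)
    (hfp : Function.Periodic f L) (hh : ContDiff ℝ ((⊤ : ℕ∞) : WithTop ℕ∞) h) {K : ℝ} (hK : 0 ≤ K)
    (ha : ∀ y ∈ Set.Icc a b, |h y| ≤ K * (y - a)) (hb : ∀ y ∈ Set.Icc a b, |h y| ≤ K * (b - y)) :
    cellPairing L a b ω f h
      = cellPairing L a b (fun p => V p 0) f (deriv h)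
        - cellPairing L a b (fun p => V p 1) (deriv f) h := by
  obtain ⟨H, C, hHs, hHv, hHC, hHl⟩ := exists_interior_approx hh hK ha hb
  have hf' : Continuous (deriv f) := hf.continuous_deriv (by simp)
  have hf0 := hf.continuous
  have hH0 : ∀ n, Continuous (H n) := fun n => (hHs n).continuous
  have hH' : ∀ n, Continuous (deriv (H n)) := fun n => (hHs n).continuous_deriv (by simp)
  have hn : ∀ n, ∫ p, ω p * (f p.1 * H n p.2) ∂(cellMeasure L a b)
      = ∫ p, V p 0 * (f p.1 * deriv (H n) p.2) ∂(cellMeasure L a b)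
        - ∫ p, V p 1 * (deriv f p.1 * H n p.2) ∂(cellMeasure L a b) := by
    intro n
    obtain ⟨c, d, hc, hd, hcd⟩ := hHv n
    have := hω _ ⟨isPeriodicTest_mul hf hfp (hHs n), c, d, hc, hd, fun x y hy => by
      simp only [hcd y hy, mul_zero]⟩
    simp_rw [partialX_mul_fst_snd (hf.differentiable (by simp)) ((hHs n).differentiable (by simp)),
      partialY_mul_fst_snd (hf.differentiable (by simp)) ((hHs n).differentiable (by simp))] at this
    have c0 := hH0 n
    have c1 := hH' n
    rw [this, integral_sub (integrable_mul_of_continuous h0 (by fun_prop))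
      (integrable_mul_of_continuous h1 (by fun_prop))]
  have l1 := tendsto_integral_mul_of_bounded hωi hf0 hH0 (fun n y hy => (hHC n y hy).1)
    (fun y hy => (hHl y hy).mono fun n h => h.1)
  have l2 := tendsto_integral_mul_of_bounded h0 hf0 hH' (fun n y hy => (hHC n y hy).2)
    (fun y hy => (hHl y hy).mono fun n h => h.2)
  have l3 := tendsto_integral_mul_of_bounded h1 hf' hH0 (fun n y hy => (hHC n y hy).1)
    (fun y hy => (hHl y hy).mono fun n h => h.1)
  exact tendsto_nhds_unique l1 ((l2.sub l3).congr fun n => (hn n).symm)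

/-! ### Fourier coefficients and the Biot-Savart identity -/

lemma CellL2.memLp_apply (V : CellL2 L a b) (i : Fin 2) :
    MemLp (fun p => V p i) 2 (cellMeasure L a b) :=
  (EuclideanSpace.proj i : Vel →L[ℝ] ℝ).comp_memLp' (Lp.memLp V)

lemma CellL2.integrable_apply (V : CellL2 L a b) (i : Fin 2) :
    Integrable (fun p => V p i) (cellMeasure L a b) :=
  (CellL2.memLp_apply V i).integrable one_le_two

lemma CellL2.norm_sq_eq (V : CellL2 L a b) :
    ‖V‖ ^ 2 = ∫ p, V p 0 ^ 2 ∂(cellMeasure L a b) + ∫ p, V p 1 ^ 2 ∂(cellMeasure L a b) := by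
  rw [← integral_add (CellL2.memLp_apply V 0).integrable_sq (CellL2.memLp_apply V 1).integrable_sq,
    ← real_inner_self_eq_norm_sq, L2.inner_def]
  refine integral_congr_ae (.of_forall fun p => ?_)
  simp only [real_inner_self_eq_norm_sq, EuclideanSpace.norm_sq_eq, Fin.sum_univ_two,
    Real.norm_eq_abs, sq_abs]

lemma cellPairing_sub {g g' : ℝ × ℝ → ℝ} (hg : Integrable g (cellMeasure L a b))
    (hg' : Integrable g' (cellMeasure L a b)) {f h : ℝ → ℝ} (hf : Continuous f)
    (hh : Continuous h) :
    cellPairing L a b (fun p => g p - g' p) f h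
      = cellPairing L a b g f h - cellPairing L a b g' f h := by
  unfold cellPairing
  rw [← integral_sub (integrable_mul_of_continuous hg (by fun_prop))
    (integrable_mul_of_continuous hg' (by fun_prop))]
  simp only [sub_mul]

lemma cellPairing_mul_left (g : ℝ × ℝ → ℝ) (c : ℝ) (f h : ℝ → ℝ) :
    cellPairing L a b g (fun x => c * f x) h = c * cellPairing L a b g f h := by
  unfold cellPairing
  rw [← integral_const_mul]
  congr 1 with p
  ring

lemma cellPairing_mul_right (g : ℝ × ℝ → ℝ) (c : ℝ) (f h : ℝ → ℝ) :
    cellPairing L a b g f (fun x => c * h x) = c * cellPairing L a b g f h := by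
  unfold cellPairing
  rw [← integral_const_mul]
  congr 1 with p
  ring

/-- `cos(αx)` -/
def cosX (L : ℝ) (m : ℤ) (x : ℝ) : ℝ := Real.cos (waveX L m * x)

/-- `sin(αx)` -/
def sinX (L : ℝ) (m : ℤ) (x : ℝ) : ℝ := Real.sin (waveX L m * x)

/-- `cos(β(y-a))` -/
def cosY (a b : ℝ) (k : ℤ) (y : ℝ) : ℝ := Real.cos (waveY a b k * (y - a))

/-- `sin(β(y-a))` -/
def sinY (a b : ℝ) (k : ℤ) (y : ℝ) : ℝ := Real.sin (waveY a b k * (y - a))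

lemma contDiff_cosX (m : ℤ) : ContDiff ℝ ((⊤ : ℕ∞) : WithTop ℕ∞) (cosX L m) := by
  unfold cosX; fun_prop

lemma contDiff_sinX (m : ℤ) : ContDiff ℝ ((⊤ : ℕ∞) : WithTop ℕ∞) (sinX L m) := by
  unfold sinX; fun_prop

lemma contDiff_cosY (k : ℤ) : ContDiff ℝ ((⊤ : ℕ∞) : WithTop ℕ∞) (cosY a b k) := by
  unfold cosY; fun_prop

lemma contDiff_sinY (k : ℤ) : ContDiff ℝ ((⊤ : ℕ∞) : WithTop ℕ∞) (sinY a b k) := by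
  unfold sinY; fun_prop

lemma deriv_cosX (m : ℤ) : deriv (cosX L m) = fun x => -waveX L m * sinX L m x := by
  ext x
  have h : HasDerivAt (fun x => waveX L m * x) (waveX L m) x := by
    simpa using (hasDerivAt_id x).const_mul (waveX L m)
  exact h.cos.deriv.trans (by unfold sinX; ring)

lemma deriv_sinX (m : ℤ) : deriv (sinX L m) = fun x => waveX L m * cosX L m x := by
  ext x
  have h : HasDerivAt (fun x => waveX L m * x) (waveX L m) x := by
    simpa using (hasDerivAt_id x).const_mul (waveX L m)
  exact h.sin.deriv.trans (by unfold cosX; ring)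

lemma deriv_cosY (k : ℤ) : deriv (cosY a b k) = fun y => -waveY a b k * sinY a b k y := by
  ext y
  have h : HasDerivAt (fun y => waveY a b k * (y - a)) (waveY a b k) y := by
    simpa using ((hasDerivAt_id y).sub_const a).const_mul (waveY a b k)
  exact h.cos.deriv.trans (by unfold sinY; ring)

lemma deriv_sinY (k : ℤ) : deriv (sinY a b k) = fun y => waveY a b k * cosY a b k y := by
  ext y
  have h : HasDerivAt (fun y => waveY a b k * (y - a)) (waveY a b k) y := by
    simpa using ((hasDerivAt_id y).sub_const a).const_mul (waveY a b k)
  exact h.sin.deriv.trans (by unfold cosY; ring)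

lemma periodic_cosX (hL : 0 < L) (m : ℤ) : Function.Periodic (cosX L m) L := by
  intro x
  have : waveX L m * (x + L) = waveX L m * x + m * (2 * Real.pi) := by
    unfold waveX; field_simp
  rw [cosX, this, Real.cos_add_int_mul_two_pi, cosX]

lemma periodic_sinX (hL : 0 < L) (m : ℤ) : Function.Periodic (sinX L m) L := by
  intro x
  have : waveX L m * (x + L) = waveX L m * x + m * (2 * Real.pi) := by
    unfold waveX; field_simp
  rw [sinX, this, Real.sin_add_int_mul_two_pi, sinX]

lemma abs_sinY_le_left (k : ℤ) {y : ℝ} (hy : y ∈ Set.Icc a b) :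
    |sinY a b k y| ≤ |waveY a b k| * (y - a) := by
  refine Real.abs_sin_le_abs.trans_eq ?_
  rw [abs_mul, abs_of_nonneg (sub_nonneg.2 hy.1)]

/-- Since β(b-a) = kπ, the sine equals sin(β(b-y)) up to sign. -/
lemma abs_sinY_le_right (hab : a < b) (k : ℤ) {y : ℝ} (hy : y ∈ Set.Icc a b) :
    |sinY a b k y| ≤ |waveY a b k| * (b - y) := by
  have hH : b - a ≠ 0 := (sub_pos.2 hab).ne'
  have h : waveY a b k * (y - a) = k * Real.pi - waveY a b k * (b - y) := by
    unfold waveY; field_simp; ring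
  rw [sinY, h, Real.sin_int_mul_pi_sub, abs_neg, abs_mul, abs_neg_one_zpow, one_mul]
  refine Real.abs_sin_le_abs.trans_eq ?_
  rw [abs_mul, abs_of_nonneg (sub_nonneg.2 hy.2)]

/-- The Fourier coefficients of a velocity field: `u` against `e^{iαx} cos(β(y-a))` and `v` against
`e^{iαx} sin(β(y-a))`. -/
def velCoeff (L a b : ℝ) (n : ℤ × ℤ) (V : CellL2 L a b) : EuclideanSpace ℝ (Fin 4) :=
  !₂[cellPairing L a b (fun p => V p 0) (cosX L n.1) (cosY a b n.2),
    cellPairing L a b (fun p => V p 0) (sinX L n.1) (cosY a b n.2),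
    cellPairing L a b (fun p => V p 1) (cosX L n.1) (sinY a b n.2),
    cellPairing L a b (fun p => V p 1) (sinX L n.1) (sinY a b n.2)]

/-- The squared modulus of the Fourier coefficient of the vorticity against
`e^{iαx} sin(β(y-a))`. -/
def vortCoeffSq (L a b : ℝ) (n : ℤ × ℤ) (ω : ℝ × ℝ → ℝ) : ℝ :=
  cellPairing L a b ω (cosX L n.1) (sinY a b n.2) ^ 2
    + cellPairing L a b ω (sinX L n.1) (sinY a b n.2) ^ 2

lemma norm_velCoeff_sq (n : ℤ × ℤ) (V : CellL2 L a b) :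
    ‖velCoeff L a b n V‖ ^ 2
      = cellPairing L a b (fun p => V p 0) (cosX L n.1) (cosY a b n.2) ^ 2
        + cellPairing L a b (fun p => V p 0) (sinX L n.1) (cosY a b n.2) ^ 2
        + (cellPairing L a b (fun p => V p 1) (cosX L n.1) (sinY a b n.2) ^ 2
        + cellPairing L a b (fun p => V p 1) (sinX L n.1) (sinY a b n.2) ^ 2) := by
  rw [EuclideanSpace.norm_sq_eq, Fin.sum_univ_four]
  simp [velCoeff, add_assoc]

lemma velCoeff_sub (n : ℤ × ℤ) (V W : CellL2 L a b) :
    velCoeff L a b n (V - W) = velCoeff L a b n V - velCoeff L a b n W := by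
  have h : ∀ (i : Fin 2) {f h : ℝ → ℝ}, Continuous f → Continuous h →
      cellPairing L a b (fun p => (V - W : CellL2 L a b) p i) f h
        = cellPairing L a b (fun p => V p i) f h - cellPairing L a b (fun p => W p i) f h := by
    intro i f h hf hh
    rw [← cellPairing_sub (CellL2.integrable_apply V i) (CellL2.integrable_apply W i) hf hh]
    refine integral_congr_ae ?_
    filter_upwards [Lp.coeFn_sub V W] with p hp
    rw [hp]
    rfl
  have h1 := (contDiff_cosX (L := L) n.1).continuous
  have h2 := (contDiff_sinX (L := L) n.1).continuous
  have h3 := (contDiff_cosY (a := a) (b := b) n.2).continuous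
  have h4 := (contDiff_sinY (a := a) (b := b) n.2).continuous
  rw [velCoeff, velCoeff, velCoeff, h _ h1 h3, h _ h1 h4, h _ h2 h3, h _ h2 h4]
  ext i
  fin_cases i <;> rfl

/-- Parseval's identity for velocity fields. -/
lemma hasSum_norm_velCoeff_sq (hL : 0 < L) (hab : a < b) (V : CellL2 L a b) :
    HasSum (fun n => ‖velCoeff L a b n V‖ ^ 2) (L * (b - a) * ‖V‖ ^ 2) := by
  simp_rw [norm_velCoeff_sq]
  rw [CellL2.norm_sq_eq, mul_add]
  exact (hasSum_sq_cos hL hab (CellL2.memLp_apply V 0)).add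
    (hasSum_sq_sin hL hab (CellL2.memLp_apply V 1))

/-- Parseval's identity for vorticities. -/
lemma hasSum_vortCoeffSq (hL : 0 < L) (hab : a < b) {ω : ℝ × ℝ → ℝ}
    (hω : MemLp ω 2 (cellMeasure L a b)) :
    HasSum (fun n => vortCoeffSq L a b n ω) (L * (b - a) * ∫ p, ω p ^ 2 ∂(cellMeasure L a b)) :=
  hasSum_sq_sin hL hab hω

/-- The Biot-Savart law for Fourier coefficients: `(α² + β²)(|û|² + |v̂|²) = |ω̂|²`. -/
lemma wave_sq_mul_norm_velCoeff_sq (hL : 0 < L) (hab : a < b) {V : CellL2 L a b}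
    (hV : IsIncompressibleTangent L a b V) {ω : ℝ × ℝ → ℝ} (hω : MemLp ω 2 (cellMeasure L a b))
    (hVω : IsWeakVorticity L a b V ω) (n : ℤ × ℤ) :
    (waveX L n.1 ^ 2 + waveY a b n.2 ^ 2) * ‖velCoeff L a b n V‖ ^ 2 = vortCoeffSq L a b n ω := by
  obtain ⟨m, k⟩ := n
  have i0 := CellL2.integrable_apply V 0
  have i1 := CellL2.integrable_apply V 1
  have iω := hω.integrable one_le_two
  -- The cosine profile does not vanish at the walls, so this is where tangency, and not only
  -- interior incompressibility, is used.
  have e1 := hV.integral_mul i0 i1 (contDiff_cosX m) (periodic_cosX hL m) (contDiff_cosY (a := a) (b := b) k)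
  have e2 := hV.integral_mul i0 i1 (contDiff_sinX m) (periodic_sinX hL m) (contDiff_cosY (a := a) (b := b) k)
  have e3 := hVω.integral_mul i0 i1 iω (contDiff_cosX m) (periodic_cosX hL m) (contDiff_sinY k)
    (abs_nonneg (waveY a b k)) (fun y hy => abs_sinY_le_left k hy)
    (fun y hy => abs_sinY_le_right hab k hy)
  have e4 := hVω.integral_mul i0 i1 iω (contDiff_sinX m) (periodic_sinX hL m) (contDiff_sinY k)
    (abs_nonneg (waveY a b k)) (fun y hy => abs_sinY_le_left k hy)
    (fun y hy => abs_sinY_le_right hab k hy)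
  simp only [deriv_cosX, deriv_sinX, deriv_cosY, deriv_sinY,
    cellPairing_mul_left, cellPairing_mul_right] at e1 e2 e3 e4
  rw [norm_velCoeff_sq, vortCoeffSq]
  simp only
  rw [e3, e4]
  set α := waveX L m
  set β := waveY a b k
  set Uc := cellPairing L a b (fun p => V p 0) (cosX L m) (cosY a b k)
  set Us := cellPairing L a b (fun p => V p 0) (sinX L m) (cosY a b k)
  set Vc := cellPairing L a b (fun p => V p 1) (cosX L m) (sinY a b k)
  set Vs := cellPairing L a b (fun p => V p 1) (sinX L m) (sinY a b k)
  have e1' : α * Us = -(β * Vc) := by linarith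
  have e2' : α * Uc = β * Vs := by linarith
  -- Lagrange's identity: the left side minus |ω̂|² is (αUs + βVc)² + (αUc - βVs)², and both squares
  -- vanish by incompressibility.
  linear_combination (α * Us + β * Vc) * e1' + (α * Uc - β * Vs) * e2'

/-- The vorticity gives no control where α = β = 0. There every coefficient has a factor sin 0
except the mean of `u`. -/
lemma velCoeff_zero {V : CellL2 L a b} (hV : IsChannelVelocity L a b V) :
    velCoeff L a b 0 V = 0 := by
  have h := hV.average_u
  ext i
  fin_cases i <;> simp [velCoeff, cellPairing, cosX, sinX, cosY, sinY, waveX, waveY, h]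

/-! ### Total boundedness from decay of coefficients -/

/-- A set is totally bounded if its coefficients in a Parseval system are bounded and have uniformly
small tails. -/
theorem totallyBounded_of_coeff {E ι G : Type*} [PseudoMetricSpace E] [NormedAddCommGroup G]
    [ProperSpace G] {S : Set E} {c : ι → E → G} {A : ℝ} (hA : 0 < A)
    (hdist : ∀ x y, HasSum (fun i => ‖c i x - c i y‖ ^ 2) (A * dist x y ^ 2))
    (hbdd : ∀ i, ∃ B, ∀ x ∈ S, ‖c i x‖ ≤ B)
    (htail : ∀ ε > 0, ∃ F : Finset ι, ∀ x ∈ S, ∀ T : Finset ι, Disjoint T F →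
      ∑ i ∈ T, ‖c i x‖ ^ 2 ≤ ε) : TotallyBounded S := by
  classical
  refine Metric.totallyBounded_iff.2 fun ε hε => ?_
  -- A tail of a difference costs at most 2(1/16 + 1/16) = 1/4 of Aε²; the head over `F` gets
  -- another 1/4, and the total 1/2 leaves a strict inequality.
  obtain ⟨F, hF⟩ := htail (A * ε ^ 2 / 16) (by positivity)
  let Φ : E → F → G := fun x i => c i x
  have hΦ : TotallyBounded (Φ '' S) := by
    choose B hB using hbdd
    refine TotallyBounded.subset ?_ (isCompact_univ_pi fun i : F =>
      isCompact_closedBall (0 : G) (B i)).totallyBounded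
    rintro _ ⟨x, hx, rfl⟩ i -
    simpa [Φ] using hB i x hx
  obtain ⟨η, hη, hηF⟩ : ∃ η > 0, F.card * η ^ 2 ≤ A * ε ^ 2 / 4 := by
    refine ⟨Real.sqrt (A * ε ^ 2 / (4 * (F.card + 1))), by positivity, ?_⟩
    rw [Real.sq_sqrt (by positivity), ← mul_div_assoc,
      div_le_div_iff₀ (by positivity) (by positivity)]
    nlinarith [show 0 < A * ε ^ 2 by positivity]
  -- The net is taken inside the image of `S`, so that its centres lift to points of `S` and obey
  -- the tail bound.
  obtain ⟨s, hsS, hsf, hcov⟩ := Set.exists_subset_image_finite_and.1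
    (Metric.finite_approx_of_totallyBounded hΦ η hη)
  refine ⟨s, hsf, fun x hx => ?_⟩
  obtain ⟨_, ⟨y, hy, rfl⟩, hxy⟩ := Set.mem_iUnion₂.1 (hcov (Set.mem_image_of_mem Φ hx))
  refine Set.mem_iUnion₂.2 ⟨y, hy, ?_⟩
  have hle : A * dist x y ^ 2 ≤ A * ε ^ 2 / 4 + A * ε ^ 2 / 4 := by
    refine hasSum_le_of_sum_le (hdist x y) fun T => ?_
    rw [← Finset.sum_inter_add_sum_sdiff T F]
    refine add_le_add (le_trans ?_ hηF) ?_
    · refine (Finset.sum_le_sum_of_subset_of_nonneg Finset.inter_subset_right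
        fun i _ _ => sq_nonneg _).trans ?_
      rw [← nsmul_eq_mul]
      refine Finset.sum_le_card_nsmul _ _ _ fun i hi => ?_
      have h1 : dist (Φ x ⟨i, hi⟩) (Φ y ⟨i, hi⟩) ≤ dist (Φ x) (Φ y) := dist_le_pi_dist _ _ _
      rw [dist_eq_norm] at h1
      exact pow_le_pow_left₀ (norm_nonneg _) (h1.trans (Metric.mem_ball.1 hxy).le) 2
    · calc ∑ i ∈ T \ F, ‖c i x - c i y‖ ^ 2
          ≤ ∑ i ∈ T \ F, 2 * (‖c i x‖ ^ 2 + ‖c i y‖ ^ 2) := Finset.sum_le_sum fun i _ =>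
            (pow_le_pow_left₀ (norm_nonneg _) (norm_sub_le _ _) 2).trans add_sq_le
        _ = 2 * (∑ i ∈ T \ F, ‖c i x‖ ^ 2 + ∑ i ∈ T \ F, ‖c i y‖ ^ 2) := by
            rw [← Finset.mul_sum, Finset.sum_add_distrib]
        _ ≤ 2 * (A * ε ^ 2 / 16 + A * ε ^ 2 / 16) := by
            gcongr
            · exact hF x hx _ Finset.sdiff_disjoint
            · exact hF y (hsS hy) _ Finset.sdiff_disjoint
        _ = A * ε ^ 2 / 4 := by ring
  have hlt : dist x y ^ 2 < ε ^ 2 := by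
    by_contra! h
    nlinarith [mul_le_mul_of_nonneg_left h hA.le, mul_pos hA (pow_pos hε 2)]
  exact Metric.mem_ball.2 (lt_of_pow_lt_pow_left₀ 2 hε.le hlt)

/-- All but finitely many wave vectors are large. -/
lemma exists_finset_wave_sq_ge (hL : 0 < L) (hab : a < b) (R : ℝ) :
    ∃ F : Finset (ℤ × ℤ), ∀ n ∉ F, R ≤ waveX L n.1 ^ 2 + waveY a b n.2 ^ 2 := by
  have hH : 0 < b - a := sub_pos.2 hab
  have hpi := Real.pi_pos
  obtain ⟨c, hc, hcX, hcY⟩ : ∃ c > 0, c ≤ 2 * Real.pi / L ∧ c ≤ Real.pi / (b - a) :=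
    ⟨min (2 * Real.pi / L) (Real.pi / (b - a)), by positivity, min_le_left _ _, min_le_right _ _⟩
  -- The added 1 ensures that N² dominates |R|/c² without a square root.
  obtain ⟨N, hN⟩ := exists_nat_ge (|R| / c ^ 2 + 1)
  have hsq : ∀ (d : ℝ) (m : ℤ), c ≤ d → (m < -(N : ℤ) ∨ (N : ℤ) < m) → R ≤ (d * m) ^ 2 := by
    intro d m hd hm
    have h1 : (N : ℝ) ≤ |(m : ℝ)| := by
      have : (N : ℤ) ≤ |m| := by rcases hm with h | h <;> [rw [abs_of_neg (by omega)];
        rw [abs_of_pos (by omega)]] <;> omega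
      exact_mod_cast this
    have h2 : |R| / c ^ 2 ≤ (N : ℝ) ^ 2 := by
      have : 0 ≤ |R| / c ^ 2 := by positivity
      nlinarith
    calc R ≤ |R| := le_abs_self R
      _ ≤ c ^ 2 * (N : ℝ) ^ 2 := by rwa [div_le_iff₀' (by positivity)] at h2
      _ ≤ d ^ 2 * |(m : ℝ)| ^ 2 := by gcongr
      _ = (d * m) ^ 2 := by rw [sq_abs, mul_pow]
  refine ⟨Finset.Icc (-(N : ℤ)) N ×ˢ Finset.Icc (-(N : ℤ)) N, fun n hn => ?_⟩
  rw [Finset.mem_product, Finset.mem_Icc, Finset.mem_Icc, not_and_or, not_and_or, not_and_or,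
    not_le, not_le, not_le, not_le] at hn
  have eX : waveX L n.1 = 2 * Real.pi / L * n.1 := by unfold waveX; ring
  have eY : waveY a b n.2 = Real.pi / (b - a) * n.2 := by unfold waveY; ring
  rcases hn with h | h
  · exact (eX ▸ hsq _ _ hcX h).trans (le_add_of_nonneg_right (sq_nonneg _))
  · exact (eY ▸ hsq _ _ hcY h).trans (le_add_of_nonneg_left (sq_nonneg _))

lemma wave_sq_pos (hL : 0 < L) (hab : a < b) {n : ℤ × ℤ} (hn : n ≠ 0) :
    0 < waveX L n.1 ^ 2 + waveY a b n.2 ^ 2 := by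
  have hH : b - a ≠ 0 := (sub_pos.2 hab).ne'
  have hpi := Real.pi_ne_zero
  by_cases h : n.1 = 0
  · have h2 : n.2 ≠ 0 := fun h2 => hn (Prod.ext h h2)
    have : waveY a b n.2 ≠ 0 := by unfold waveY; positivity
    positivity
  · have : waveX L n.1 ≠ 0 := by unfold waveX; positivity
    positivity

lemma vortCoeffSq_nonneg (n : ℤ × ℤ) (ω : ℝ × ℝ → ℝ) : 0 ≤ vortCoeffSq L a b n ω := by
  unfold vortCoeffSq; positivity

theorem totallyBounded_enstrophyBall (hL : 0 < L) (hab : a < b) {C : ℝ} (hC : 0 < C) :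
    TotallyBounded (enstrophyBall L a b C) := by
  have hA : 0 < L * (b - a) := mul_pos hL (sub_pos.2 hab)
  have hsum : ∀ ω : ℝ × ℝ → ℝ, MemLp ω 2 (cellMeasure L a b) →
      ∫ p, ω p ^ 2 ∂(cellMeasure L a b) ≤ C → ∀ T : Finset (ℤ × ℤ),
      ∑ n ∈ T, vortCoeffSq L a b n ω ≤ L * (b - a) * C := fun ω hω hωC T =>
    (sum_le_hasSum T (fun n _ => vortCoeffSq_nonneg n ω) (hasSum_vortCoeffSq hL hab hω)).trans
      (mul_le_mul_of_nonneg_left hωC hA.le)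
  refine totallyBounded_of_coeff (c := velCoeff L a b) hA (fun V W => ?_) (fun n => ?_)
    (fun ε hε => ?_)
  · simp_rw [← velCoeff_sub]
    rw [dist_eq_norm]
    exact hasSum_norm_velCoeff_sq hL hab (V - W)
  · by_cases hn : n = 0
    · exact ⟨0, fun V hV => by rw [hn, velCoeff_zero hV.1, norm_zero]⟩
    · have hw := wave_sq_pos hL hab hn
      refine ⟨Real.sqrt (L * (b - a) * C / (waveX L n.1 ^ 2 + waveY a b n.2 ^ 2)), ?_⟩
      rintro V ⟨hV, ω, hω, hVω, hωC⟩
      refine Real.le_sqrt_of_sq_le ?_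
      rw [le_div_iff₀' hw,
        wave_sq_mul_norm_velCoeff_sq hL hab hV.incompressible_tangent hω hVω]
      simpa using hsum ω hω hωC {n}
  -- Outside `F` each squared velocity coefficient is at most ε/(L(b-a)C) times the vorticity one,
  -- and the latter sum to at most L(b-a)C.
  · obtain ⟨F, hF⟩ := exists_finset_wave_sq_ge hL hab (L * (b - a) * C / ε)
    refine ⟨F, ?_⟩
    rintro V ⟨hV, ω, hω, hVω, hωC⟩ T hT
    have h1 : L * (b - a) * C / ε * ∑ n ∈ T, ‖velCoeff L a b n V‖ ^ 2 ≤ L * (b - a) * C := by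
      refine le_trans ?_ (hsum ω hω hωC T)
      rw [Finset.mul_sum]
      refine Finset.sum_le_sum fun n hn => ?_
      rw [← wave_sq_mul_norm_velCoeff_sq hL hab hV.incompressible_tangent hω hVω]
      exact mul_le_mul_of_nonneg_right (hF n (Finset.disjoint_left.1 hT hn)) (sq_nonneg _)
    have hAC : 0 < L * (b - a) * C := mul_pos hA hC
    rw [div_mul_eq_mul_div, div_le_iff₀ hε] at h1
    exact le_of_mul_le_mul_left h1 hAC

end

theorem mainTheorem3 (L a b : ℝ) (hL : 0 < L) (hab : a < b) (C : ℝ) (hC : 0 < C) :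
    IsCompact (closure (enstrophyBall L a b C)) :=
  (totallyBounded_enstrophyBall hL hab hC).closure.isCompact_of_isClosed isClosed_closure
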